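/- Let $M$ be a finite-dimensional smooth manifold (without boundary) and let $g$ be a smooth pseudo-Riemannian metric on $M$, i.e. a smooth field of symmetric nondegenerate bilinear forms, of any signature, on the tangent spaces. Let $\nabla$ be the Levi-Civita connection of $g$, with Christoffel symbols $\Gamma_{ij}^k$, and let $TM$ be the tangent bundle, with the induced coordinates $(x^k,y^k)$. For $u=(x,y)\in TM$ and $X\in T_xM$ let $X^H$ and $X^V$ be the horizontal and the vertical lift of $X$ to $T_u(TM)$, which have in the induced coordinates the components $(X^k,\,-y^i\Gamma_{ij}^kX^j)$ and $(0,X^k)$. The Sasaki metric $\hat g$ on $TM$ is the field of bilinear forms with $$\hat g(X^H,Y^H)=\hat g(X^V,Y^V)=g(X,Y),\qquad \hat g(X^H,Y^V)=\hat g(X^V,Y^H)=0$$ for all $u\in TM$ and all $X,Y\in T_xM$, where $x$ is the base point of $u$. Then $\hat g$ is a smooth pseudo-Riemannian metric on $TM$, and $(TM,\hat g)$ is flat if and only if $(M,g)$ is flat, where a pseudo-Riemannian manifold is called flat if the curvature tensor $R(X,Y)Z=\nabla_X\nabla_YZ-\nabla_Y\nabla_XZ-\nabla_{[X,Y]}Z$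 of its Levi-Civita connection vanishes identically. -/

import Mathlib

set_option maxSynthPendingDepth 3

open scoped Manifold ContDiff

noncomputable section

section Metric

variable {E : Type*} [NormedAddCommGroup E] [NormedSpace ℝ E]
  {H : Type*} [TopologicalSpace H] (I : ModelWithCorners ℝ E H)
  {M : Type*} [TopologicalSpace M] [ChartedSpace H M]

/-- A smooth pseudo-Riemannian metric: a smooth field of symmetric nondegenerate bilinear forms
on the tangent spaces. No condition on the signature is imposed (nondegeneracy and continuity make
it locally constant). -/
structure IsPseudoRiemannianMetric [IsManifold I ∞ M]
    (g : ∀ x : M, TangentSpace I x →L[ℝ] TangentSpace I x →L[ℝ] ℝ) : Prop where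
  symm : ∀ (x : M) (v w : TangentSpace I x), g x v w = g x w v
  nondegenerate : ∀ (x : M) (v : TangentSpace I x), (∀ w, g x v w = 0) → v = 0
  contMDiff : ContMDiff I (I.prod 𝓘(ℝ, E →L[ℝ] E →L[ℝ] ℝ)) ∞
    (fun x ↦ Bundle.TotalSpace.mk' (E →L[ℝ] E →L[ℝ] ℝ)
      (E := fun x : M ↦ TangentSpace I x →L[ℝ] TangentSpace I x →L[ℝ] ℝ) x (g x))

/-- The metric in the local coordinates of the chart `φ` around `x₀`, i.e. the pull-back of `g`
under `φ⁻¹`: it sends a point `y` of the target of `φ` to the bilinear form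
`(v, w) ↦ g (dφ⁻¹ v, dφ⁻¹ w)`, whose entries are the `g_{ij}(y)`. -/
def coordMetric (g : ∀ x : M, TangentSpace I x →L[ℝ] TangentSpace I x →L[ℝ] ℝ)
    (x₀ : M) (y : E) : E →L[ℝ] E →L[ℝ] ℝ :=
  let T : E →L[ℝ] TangentSpace I ((extChartAt I x₀).symm y) :=
    mfderiv 𝓘(ℝ, E) I (extChartAt I x₀).symm y
  (T.precomp ℝ).comp ((g ((extChartAt I x₀).symm y)).comp T)

/-- The Christoffel symbols of the first kind in the chart around `x₀`, as the trilinear map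
`(v, w, z) ↦ (∂_v g(w, z) + ∂_w g(v, z) - ∂_z g(v, w)) / 2`. -/
def christoffelFirst (g : ∀ x : M, TangentSpace I x →L[ℝ] TangentSpace I x →L[ℝ] ℝ)
    (x₀ : M) (y : E) : E →L[ℝ] E →L[ℝ] E →L[ℝ] ℝ :=
  letI D : E →L[ℝ] E →L[ℝ] E →L[ℝ] ℝ := fderiv ℝ (coordMetric I g x₀) y
  letI F : (E →L[ℝ] E →L[ℝ] ℝ) →L[ℝ] E →L[ℝ] E →L[ℝ] ℝ :=
    (ContinuousLinearMap.flipₗᵢ ℝ E E ℝ).toContinuousLinearEquiv.toContinuousLinearMap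
  (1 / 2 : ℝ) • (D + D.flip - F.comp D.flip)

theorem christoffelFirst_apply
    (g : ∀ x : M, TangentSpace I x →L[ℝ] TangentSpace I x →L[ℝ] ℝ) (x₀ : M) (y v w z : E) :
    christoffelFirst I g x₀ y v w z = (1 / 2 : ℝ) *
      (fderiv ℝ (coordMetric I g x₀) y v w z + fderiv ℝ (coordMetric I g x₀) y w v z
        - fderiv ℝ (coordMetric I g x₀) y z v w) := by
  simp [christoffelFirst]

/-- The Christoffel symbols `Γ` of the Levi-Civita connection of `g` in the chart around `x₀`:
`Γ v w` is the vector such that `g (Γ v w, z)` is the Christoffel symbol of the first kind of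
`v, w, z` for all `z`, so that `∇_v W = ∂_v W + Γ v W` in coordinates. Here the bilinear form `g`
is inverted as a map from `E` to its dual. -/
def christoffel (g : ∀ x : M, TangentSpace I x →L[ℝ] TangentSpace I x →L[ℝ] ℝ)
    (x₀ : M) (y : E) : E →L[ℝ] E →L[ℝ] E :=
  (ContinuousLinearMap.compL ℝ E (E →L[ℝ] ℝ) E (coordMetric I g x₀ y).inverse).comp
    (christoffelFirst I g x₀ y)

theorem coordMetric_christoffel [FiniteDimensional ℝ E]
    (g : ∀ x : M, TangentSpace I x →L[ℝ] TangentSpace I x →L[ℝ] ℝ) (x₀ : M) (y : E)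
    (h : ∀ v, (∀ w, coordMetric I g x₀ y v w = 0) → v = 0) (v w z : E) :
    coordMetric I g x₀ y (christoffel I g x₀ y v w) z = christoffelFirst I g x₀ y v w z := by
  have hinv : (coordMetric I g x₀ y).IsInvertible := by
    let B : E →ₗ[ℝ] (E →L[ℝ] ℝ) := (coordMetric I g x₀ y).toLinearMap
    have hinj : Function.Injective B := by
      rw [← LinearMap.ker_eq_bot, LinearMap.ker_eq_bot']
      intro m hm
      refine h m fun w ↦ ?_
      exact congrArg (fun f : E →L[ℝ] ℝ ↦ f w) hm
    have hdim : Module.finrank ℝ E = Module.finrank ℝ (E →L[ℝ] ℝ) := by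
      rw [← (LinearMap.toContinuousLinearMap (𝕜 := ℝ) (E := E) (F' := ℝ)).finrank_eq]
      exact (Subspace.dual_finrank_eq (K := ℝ) (V := E)).symm
    exact ⟨(B.linearEquivOfInjective hinj hdim).toContinuousLinearEquiv, by ext; rfl⟩
  have := hinv.self_apply_inverse (christoffelFirst I g x₀ y v w)
  exact congrArg (fun f : E →L[ℝ] ℝ ↦ f z) this

/-- The curvature tensor `R(a, b)c = ∇_a ∇_b c - ∇_b ∇_a c - ∇_{[a, b]} c` of the Levi-Civita
connection of `g`, in the chart around `x₀` (for constant coordinate fields `a, b, c`). -/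
def curvature (g : ∀ x : M, TangentSpace I x →L[ℝ] TangentSpace I x →L[ℝ] ℝ)
    (x₀ : M) (y a b c : E) : E :=
  fderiv ℝ (christoffel I g x₀) y a b c - fderiv ℝ (christoffel I g x₀) y b a c
    + christoffel I g x₀ y a (christoffel I g x₀ y b c)
    - christoffel I g x₀ y b (christoffel I g x₀ y a c)

/-- The metric `g` is flat: the curvature tensor of its Levi-Civita connection vanishes
identically, i.e. its components vanish throughout every chart of the atlas given by `extChartAt`
(these charts cover the manifold). -/
def IsFlatMetric (g : ∀ x : M, TangentSpace I x →L[ℝ] TangentSpace I x →L[ℝ] ℝ) : Prop :=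
  ∀ x₀ : M, ∀ y ∈ (extChartAt I x₀).target, ∀ a b c : E, curvature I g x₀ y a b c = 0

end Metric

section Sasaki

variable {E : Type*} [NormedAddCommGroup E] [NormedSpace ℝ E]
  {H : Type*} [TopologicalSpace H] (I : ModelWithCorners ℝ E H)
  {M : Type*} [TopologicalSpace M] [ChartedSpace H M] [IsManifold I ∞ M]

/-- The differential of the bundle projection `TM → M` at `p`. The chart of `TM` around `p` is the
one of the induced coordinates `(x^k, y^k)` of the chart of `M` around `p.proj`. In Mathlib a
tangent vector is represented by its components in the preferred chart around its base point, so a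
tangent vector to `TM` at `p` is the pair of its components `(X^k, Y^k)` in these coordinates. -/
def horizontalPart (p : TangentBundle I M) :
    TangentSpace I.tangent p →L[ℝ] TangentSpace I p.proj :=
  ContinuousLinearMap.fst ℝ E E

theorem horizontalPart_eq_mfderiv (p : TangentBundle I M) :
    horizontalPart I p = mfderiv I.tangent I (fun q : TangentBundle I M ↦ q.proj) p := by
  have hd : MDifferentiableAt I.tangent I (fun q : TangentBundle I M ↦ q.proj) p :=
    (Bundle.contMDiffAt_proj (n := 1) (IB := I) (TangentSpace I : M → Type _)).mdifferentiableAt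
      one_ne_zero
  suffices h : HasMFDerivAt I.tangent I (fun q : TangentBundle I M ↦ q.proj) p
      (horizontalPart I p) from h.mfderiv.symm
  refine ⟨hd.continuousAt, ?_⟩
  change HasFDerivWithinAt (writtenInExtChartAt I.tangent I p fun q : TangentBundle I M ↦ q.proj)
    (ContinuousLinearMap.fst ℝ E E) (Set.range I.tangent) (extChartAt I.tangent p p)
  refine HasFDerivWithinAt.congr_of_eventuallyEq (f := Prod.fst) hasFDerivWithinAt_fst ?_ ?_
  swap
  · exact (extChartAt I p.proj).right_inv (mem_extChartAt_target p.proj)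
  filter_upwards [extChartAt_target_mem_nhdsWithin (I := I.tangent) p] with y hy
  have hy' : y.1 ∈ (extChartAt I p.proj).target := by
    simp only [extChartAt, OpenPartialHomeomorph.extend_target, ModelWithCorners.tangent] at hy ⊢
    obtain ⟨h1, h2⟩ := hy
    refine ⟨(TangentBundle.mem_chart_target_iff (I := I) _ p).1 h1, ?_⟩
    rw [ModelWithCorners.range_prod] at h2
    exact h2.1
  exact (extChartAt I p.proj).right_inv hy'

/-- The components `Γ_{ij}^k` at the point `x`, in the chart around `x` itself. -/
def christoffelAt (g : ∀ x : M, TangentSpace I x →L[ℝ] TangentSpace I x →L[ℝ] ℝ) (x : M) :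
    E →L[ℝ] E →L[ℝ] E :=
  christoffel I g x (extChartAt I x x)

/-- The connection map at `p = (x, y)` of the Levi-Civita connection of `g`, in induced coordinates
`(X^k, Y^k) ↦ Y^k + y^i Γ_{ij}^k X^j`. -/
def verticalPart (g : ∀ x : M, TangentSpace I x →L[ℝ] TangentSpace I x →L[ℝ] ℝ)
    (p : TangentBundle I M) : TangentSpace I.tangent p →L[ℝ] TangentSpace I p.proj :=
  letI u : E := p.snd
  letI L : E × E →L[ℝ] E := ContinuousLinearMap.snd ℝ E E
    + ((christoffelAt I g p.proj).flip u).comp (ContinuousLinearMap.fst ℝ E E)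
  L

/-- The Sasaki metric (diagonal lift of `g`) on the tangent bundle: the metric for which the
horizontal and the vertical distribution are orthogonal and both lifts of tangent vectors preserve
scalar products, see `sasakiMetric_horizontal_horizontal` and the lemmas that follow it. -/
def sasakiMetric (g : ∀ x : M, TangentSpace I x →L[ℝ] TangentSpace I x →L[ℝ] ℝ)
    (p : TangentBundle I M) :
    TangentSpace I.tangent p →L[ℝ] TangentSpace I.tangent p →L[ℝ] ℝ :=
  ((horizontalPart I p).precomp ℝ).comp ((g p.proj).comp (horizontalPart I p))
    + ((verticalPart I g p).precomp ℝ).comp ((g p.proj).comp (verticalPart I g p))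

/-- The horizontal lift at `p = (x, y)` of a tangent vector `X` at `x`: in induced coordinates it
has the components `(X^k, - y^i Γ_{ij}^k X^j)`. -/
def horizontalLift (g : ∀ x : M, TangentSpace I x →L[ℝ] TangentSpace I x →L[ℝ] ℝ)
    (p : TangentBundle I M) (X : TangentSpace I p.proj) : TangentSpace I.tangent p :=
  letI u : E := p.snd
  letI v : E := X
  ((v, -christoffelAt I g p.proj v u) : E × E)

/-- The vertical lift at `p` of a tangent vector `X` at `p.proj`: in induced coordinates it has the
components `(0, X^k)`. -/
def verticalLift (p : TangentBundle I M) (X : TangentSpace I p.proj) :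
    TangentSpace I.tangent p :=
  letI v : E := X
  ((0, v) : E × E)

section Lifts

variable (g : ∀ x : M, TangentSpace I x →L[ℝ] TangentSpace I x →L[ℝ] ℝ)
  (p : TangentBundle I M) (X Y : TangentSpace I p.proj)

theorem horizontalPart_horizontalLift : horizontalPart I p (horizontalLift I g p X) = X := rfl

theorem horizontalPart_verticalLift : horizontalPart I p (verticalLift I p X) = 0 := rfl

theorem verticalPart_horizontalLift : verticalPart I g p (horizontalLift I g p X) = 0 :=
  neg_add_cancel (G := E) _

theorem verticalPart_verticalLift : verticalPart I g p (verticalLift I p X) = X := by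
  let L : E →L[ℝ] E →L[ℝ] E := christoffelAt I g p.proj
  let u : E := p.snd
  let v : E := X
  change v + L 0 u = v
  simp

/-- Every tangent vector to `TM` is the sum of a horizontal and a vertical lift. -/
theorem horizontalLift_add_verticalLift (ξ : TangentSpace I.tangent p) :
    horizontalLift I g p (horizontalPart I p ξ) + verticalLift I p (verticalPart I g p ξ) = ξ := by
  let L : E →L[ℝ] E →L[ℝ] E := christoffelAt I g p.proj
  let u : E := p.snd
  let ζ : E × E := ξ
  change (ζ.1, -L ζ.1 u) + (0, ζ.2 + L ζ.1 u) = ζ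
  exact Prod.ext (add_zero _) (by change -L ζ.1 u + (ζ.2 + L ζ.1 u) = ζ.2; abel)

theorem sasakiMetric_apply (ξ η : TangentSpace I.tangent p) :
    sasakiMetric I g p ξ η = g p.proj (horizontalPart I p ξ) (horizontalPart I p η)
      + g p.proj (verticalPart I g p ξ) (verticalPart I g p η) := rfl

theorem sasakiMetric_horizontal_horizontal :
    sasakiMetric I g p (horizontalLift I g p X) (horizontalLift I g p Y) = g p.proj X Y := by
  simp [sasakiMetric_apply, horizontalPart_horizontalLift, verticalPart_horizontalLift]

theorem sasakiMetric_vertical_vertical :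
    sasakiMetric I g p (verticalLift I p X) (verticalLift I p Y) = g p.proj X Y := by
  simp [sasakiMetric_apply, horizontalPart_verticalLift, verticalPart_verticalLift]

theorem sasakiMetric_horizontal_vertical :
    sasakiMetric I g p (horizontalLift I g p X) (verticalLift I p Y) = 0 := by
  simp [sasakiMetric_apply, horizontalPart_verticalLift, verticalPart_horizontalLift]

theorem sasakiMetric_vertical_horizontal :
    sasakiMetric I g p (verticalLift I p X) (horizontalLift I g p Y) = 0 := by
  simp [sasakiMetric_apply, horizontalPart_verticalLift, verticalPart_horizontalLift]

end Lifts

end Sasaki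

end

/-! The horizontal and vertical parts give a bundle isomorphism `P` from `T(TM)` onto two copies of
`π^*TM`, where `π : TM → M`. Under `P` the Sasaki metric is the pull-back of `g ⊕ g`. The connection
`π^*∇ ⊕ π^*∇` is compatible with `g ⊕ g`, so its transfer through `P` is a connection on `TM`
compatible with the Sasaki metric. In induced coordinates the torsion of this transfer at `u` is
`(0, R(ξ.1, η.1) u)` after applying `P` (`gaugeDeriv_splitting`). At every `u` with `R(·, ·) u = 0`
the transfer therefore has the Christoffel symbols of the Levi-Civita connection, since these are
determined pointwise by symmetry and compatibility (`leviCivita_eq`, `map_leviCivita`).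

If `R = 0`, this holds on all of `TM`. Curvature is gauge covariant (`map_connectionCurvature`) and
that of `π^*∇ ⊕ π^*∇` consists of two copies of `R`, so `TM` is flat. Conversely, the torsion
vanishes along the zero section `u = 0` whatever `R` is. There the Christoffel symbols on vectors
tangent to the zero section are `(Γ(a, b), 0)`, and differentiating along the section recovers `R`
from the curvature of `TM`.

The transfer to manifolds rests on `coordMetric_sasakiMetric`. The Sasaki metric at a point is
defined by the chart centred there, and the transformation law of the Christoffel symbols shows that
the same formula holds throughout every induced chart. -/

noncomputable section

/-! ### Levi-Civita connections, gauge transformations and curvature on open subsets of a normed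
space -/

section LocalConnection

open scoped Topology
open ContinuousLinearMap

variable {V W : Type*} [NormedAddCommGroup V] [NormedSpace ℝ V]
  [NormedAddCommGroup W] [NormedSpace ℝ W]

/-- The Christoffel symbols of the first kind of a metric `G` on an open subset of `V`. -/
def leviCivitaFirst (G : V → V →L[ℝ] V →L[ℝ] ℝ) (y : V) : V →L[ℝ] V →L[ℝ] V →L[ℝ] ℝ :=
  letI D : V →L[ℝ] V →L[ℝ] V →L[ℝ] ℝ := fderiv ℝ G y
  letI F : (V →L[ℝ] V →L[ℝ] ℝ) →L[ℝ] V →L[ℝ] V →L[ℝ] ℝ :=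
    (ContinuousLinearMap.flipₗᵢ ℝ V V ℝ).toContinuousLinearEquiv.toContinuousLinearMap
  (1 / 2 : ℝ) • (D + D.flip - F.comp D.flip)

/-- The Christoffel symbols of the Levi-Civita connection of a metric `G` on an open subset
of `V`. -/
def leviCivita (G : V → V →L[ℝ] V →L[ℝ] ℝ) (y : V) : V →L[ℝ] V →L[ℝ] V :=
  (ContinuousLinearMap.compL ℝ V (V →L[ℝ] ℝ) V (G y).inverse).comp (leviCivitaFirst G y)

/-- The curvature of the connection `d + A` on the trivial bundle with fibre `W` over an open
subset of `V`, on constant vector fields. -/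
def connectionCurvature (A : V → V →L[ℝ] W →L[ℝ] W) (y a b : V) (c : W) : W :=
  fderiv ℝ A y a b c - fderiv ℝ A y b a c + A y a (A y b c) - A y b (A y a c)

/-- The covariant derivative of the gauge transformation `P` from the trivial bundle with fibre `V`
to the one with fibre `W`, which carries the connection `d + A`. -/
def gaugeDeriv (P : V → V →L[ℝ] W) (A : V → V →L[ℝ] W →L[ℝ] W) (x ξ η : V) : W :=
  fderiv ℝ P x ξ η + A x ξ (P x η)

theorem leviCivitaFirst_apply (G : V → V →L[ℝ] V →L[ℝ] ℝ) (y v w z : V) :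
    leviCivitaFirst G y v w z = (1 / 2 : ℝ) *
      (fderiv ℝ G y v w z + fderiv ℝ G y w v z - fderiv ℝ G y z v w) := by
  simp [leviCivitaFirst]

theorem fderiv_apply_apply {X Y Z : Type*} [NormedAddCommGroup X] [NormedSpace ℝ X]
    [NormedAddCommGroup Y] [NormedSpace ℝ Y] [NormedAddCommGroup Z] [NormedSpace ℝ Z]
    {F : V → X →L[ℝ] Y →L[ℝ] Z} {x : V} (hF : DifferentiableAt ℝ F x) (v : X) (w : Y) :
    HasFDerivAt (fun y ↦ F y v w) (((fderiv ℝ F x).flip v).flip w) x := by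
  have := (hF.hasFDerivAt.clm_apply (hasFDerivAt_const v x)).clm_apply (hasFDerivAt_const w x)
  convert! this using 1
  ext; simp

theorem isInvertible_of_nondegenerate [FiniteDimensional ℝ V] {B : V →L[ℝ] V →L[ℝ] ℝ}
    (h : ∀ v, (∀ w, B v w = 0) → v = 0) : B.IsInvertible := by
  have hinj : Function.Injective B.toLinearMap := by
    rw [← LinearMap.ker_eq_bot, LinearMap.ker_eq_bot']
    exact fun m hm ↦ h m fun w ↦ congrArg (fun f : V →L[ℝ] ℝ ↦ f w) hm
  have hdim : Module.finrank ℝ V = Module.finrank ℝ (V →L[ℝ] ℝ) := by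
    rw [← (LinearMap.toContinuousLinearMap (𝕜 := ℝ) (E := V) (F' := ℝ)).finrank_eq]
    exact (Subspace.dual_finrank_eq (K := ℝ) (V := V)).symm
  exact ⟨(B.toLinearMap.linearEquivOfInjective hinj hdim).toContinuousLinearEquiv, by ext; rfl⟩

/-- `G` is a smooth pseudo-Riemannian metric on `U`. -/
structure IsLocalMetric (G : V → V →L[ℝ] V →L[ℝ] ℝ) (U : Set V) : Prop where
  isOpen : IsOpen U
  symm : ∀ x ∈ U, ∀ v w, G x v w = G x w v
  nondegenerate : ∀ x ∈ U, ∀ v, (∀ w, G x v w = 0) → v = 0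
  contDiffOn : ContDiffOn ℝ ∞ G U

namespace IsLocalMetric

variable {G : V → V →L[ℝ] V →L[ℝ] ℝ} {U : Set V} {x : V}

theorem contDiffAt (hG : IsLocalMetric G U) (hx : x ∈ U) : ContDiffAt ℝ ∞ G x :=
  hG.contDiffOn.contDiffAt (hG.isOpen.mem_nhds hx)

theorem differentiableAt (hG : IsLocalMetric G U) (hx : x ∈ U) : DifferentiableAt ℝ G x :=
  (hG.contDiffAt hx).differentiableAt (by simp)

theorem ext_left (hG : IsLocalMetric G U) (hx : x ∈ U) {v v' : V}
    (h : ∀ z, G x v z = G x v' z) : v = v' :=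
  sub_eq_zero.1 <| hG.nondegenerate x hx _ fun w ↦ by simp [h]

/-- Nondegeneracy in finite dimension makes `(G x).inverse` a genuine inverse and not the default
value `0`, so that `leviCivita` satisfies the Koszul formula. -/
theorem apply_leviCivita [FiniteDimensional ℝ V] (hG : IsLocalMetric G U) (hx : x ∈ U)
    (v w z : V) : G x (leviCivita G x v w) z = leviCivitaFirst G x v w z := by
  have := (isInvertible_of_nondegenerate (hG.nondegenerate x hx)).self_apply_inverse
    (leviCivitaFirst G x v w)
  exact congrArg (fun f : V →L[ℝ] ℝ ↦ f z) this

theorem fderiv_symm (hG : IsLocalMetric G U) (hx : x ∈ U) (ξ v w : V) :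
    fderiv ℝ G x ξ v w = fderiv ℝ G x ξ w v := by
  have h : (fun y ↦ G y v w) =ᶠ[𝓝 x] fun y ↦ G y w v := by
    filter_upwards [hG.isOpen.mem_nhds hx] with y hy using hG.symm y hy v w
  have h1 := (fderiv_apply_apply (hG.differentiableAt hx) v w).fderiv
  have h2 := (fderiv_apply_apply (hG.differentiableAt hx) w v).fderiv
  have := DFunLike.congr_fun (h1.symm.trans (h.fderiv_eq.trans h2)) ξ
  simpa using this

theorem leviCivita_symm [FiniteDimensional ℝ V] (hG : IsLocalMetric G U) (hx : x ∈ U) (v w : V) :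
    leviCivita G x v w = leviCivita G x w v :=
  hG.ext_left hx fun z ↦ by
    rw [hG.apply_leviCivita hx, hG.apply_leviCivita hx, leviCivitaFirst_apply,
      leviCivitaFirst_apply, hG.fderiv_symm hx z v w]
    ring

/-- Compatibility with the metric: in the sum of the two symbols of the first kind, the derivatives
in the directions `v` and `w` cancel. -/
theorem fderiv_eq [FiniteDimensional ℝ V] (hG : IsLocalMetric G U) (hx : x ∈ U) (ξ v w : V) :
    fderiv ℝ G x ξ v w = G x (leviCivita G x ξ v) w + G x v (leviCivita G x ξ w) := by
  rw [hG.symm x hx v, hG.apply_leviCivita hx, hG.apply_leviCivita hx, leviCivitaFirst_apply,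
    leviCivitaFirst_apply, hG.fderiv_symm hx ξ w v]
  ring

/-- Uniqueness, by inserting `hD` into the Koszul formula: symmetry of `C` leaves only `G x (C v w)
z`. The conditions on `C` concern the single point `x`, which permits the use at isolated points and
along the zero section. -/
theorem leviCivita_eq [FiniteDimensional ℝ V] (hG : IsLocalMetric G U) (hx : x ∈ U) {C : V → V → V}
    (hC : ∀ v w, C v w = C w v)
    (hD : ∀ ξ v w, fderiv ℝ G x ξ v w = G x (C ξ v) w + G x v (C ξ w)) (v w : V) :
    leviCivita G x v w = C v w :=
  hG.ext_left hx fun z ↦ by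
    rw [hG.apply_leviCivita hx, leviCivitaFirst_apply, hD, hD, hD, hC w v, hC z v, hC z w,
      hG.symm x hx (C v z), hG.symm x hx v]
    ring

theorem contDiffOn_leviCivita [FiniteDimensional ℝ V] (hG : IsLocalMetric G U) :
    ContDiffOn ℝ ∞ (leviCivita G) U := by
  intro x hx
  apply ContDiffAt.contDiffWithinAt
  have h1 : ContDiffAt ℝ ∞ (fun y ↦ (G y).inverse) x :=
    (isInvertible_of_nondegenerate
      (hG.nondegenerate x hx)).contDiffAt_map_inverse.comp x (hG.contDiffAt hx)
  have hD : ContDiffAt ℝ ∞ (fderiv ℝ G) x := (hG.contDiffAt hx).fderiv_right (by simp)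
  have hDf : ContDiffAt ℝ ∞ (fun y ↦ (fderiv ℝ G y).flip) x :=
    (ContinuousLinearMap.flipₗᵢ ℝ V V (V →L[ℝ] ℝ)).toContinuousLinearEquiv.contDiff.contDiffAt.comp
      x hD
  have h2 : ContDiffAt ℝ ∞ (leviCivitaFirst G) x :=
    ((hD.add hDf).sub (contDiffAt_const.clm_comp hDf)).const_smul (1 / 2 : ℝ)
  have h3 : ContDiffAt ℝ ∞ (fun y ↦ ContinuousLinearMap.compL ℝ V (V →L[ℝ] ℝ) V (G y).inverse) x :=
    (ContinuousLinearMap.compL ℝ V (V →L[ℝ] ℝ) V).contDiff.contDiffAt.comp x h1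
  exact h3.clm_comp h2

theorem differentiableAt_leviCivita [FiniteDimensional ℝ V] (hG : IsLocalMetric G U)
    (hx : x ∈ U) : DifferentiableAt ℝ (leviCivita G) x :=
  (hG.contDiffOn_leviCivita.contDiffAt (hG.isOpen.mem_nhds hx)).differentiableAt (by simp)

end IsLocalMetric

theorem fderiv_pullback {G : V → V →L[ℝ] V →L[ℝ] ℝ} {B : V → W →L[ℝ] W →L[ℝ] ℝ}
    {P : V → V →L[ℝ] W} {x : V} (hG : DifferentiableAt ℝ G x) (hB : DifferentiableAt ℝ B x)
    (hP : DifferentiableAt ℝ P x) (h : ∀ᶠ y in 𝓝 x, ∀ v w, G y v w = B y (P y v) (P y w))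
    (ξ v w : V) :
    fderiv ℝ G x ξ v w = fderiv ℝ B x ξ (P x v) (P x w) + B x (fderiv ℝ P x ξ v) (P x w)
      + B x (P x v) (fderiv ℝ P x ξ w) := by
  have h1 := (fderiv_apply_apply hG v w).fderiv
  have h2 := ((hB.hasFDerivAt.clm_apply (hP.hasFDerivAt.clm_apply (hasFDerivAt_const v x))).clm_apply
    (hP.hasFDerivAt.clm_apply (hasFDerivAt_const w x))).fderiv
  have h3 : (fun y ↦ G y v w) =ᶠ[𝓝 x] fun y ↦ B y (P y v) (P y w) := by
    filter_upwards [h] with y hy using hy v w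
  have := DFunLike.congr_fun (h1.symm.trans (h3.fderiv_eq.trans h2)) ξ
  simp at this
  rw [this]; ring

/-- The Levi-Civita connection of a metric obtained from a field `B` of bilinear forms by a gauge
transformation `P` is gauge equivalent to any connection `d + A` that is compatible with `B`,
provided that the transformed connection has no torsion. -/
theorem IsLocalMetric.map_leviCivita [FiniteDimensional ℝ V] {G : V → V →L[ℝ] V →L[ℝ] ℝ}
    {U : Set V} (hG : IsLocalMetric G U) {x : V} (hx : x ∈ U) {B : V → W →L[ℝ] W →L[ℝ] ℝ}
    {P : V → V →L[ℝ] W} {A : V → V →L[ℝ] W →L[ℝ] W} (hB : DifferentiableAt ℝ B x)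
    (hP : DifferentiableAt ℝ P x) (hPinv : (P x).IsInvertible)
    (h : ∀ᶠ y in 𝓝 x, ∀ v w, G y v w = B y (P y v) (P y w))
    (hA : ∀ ξ v w, fderiv ℝ B x ξ v w = B x (A x ξ v) w + B x v (A x ξ w))
    (htors : ∀ ξ η, gaugeDeriv P A x ξ η = gaugeDeriv P A x η ξ) (ξ η : V) :
    P x (leviCivita G x ξ η) = gaugeDeriv P A x ξ η := by
  -- The candidate is `d + A` transported back through `P`. It is symmetric by `htors`; the rest
  -- checks compatibility with `G`.
  rw [hG.leviCivita_eq hx (C := fun ξ η ↦ (P x).inverse (gaugeDeriv P A x ξ η))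
    (fun v w ↦ by rw [htors]), hPinv.self_apply_inverse]
  intro ξ v w
  rw [fderiv_pullback (hG.differentiableAt hx) hB hP h, hA, h.self_of_nhds, h.self_of_nhds,
    hPinv.self_apply_inverse, hPinv.self_apply_inverse]
  simp only [gaugeDeriv, map_add, add_apply]
  ring

/-- Curvature is gauge covariant. -/
theorem map_connectionCurvature {C : V → V →L[ℝ] V →L[ℝ] V} {P : V → V →L[ℝ] W}
    {A : V → V →L[ℝ] W →L[ℝ] W} {x : V} (hC : DifferentiableAt ℝ C x) (hP : ContDiffAt ℝ 2 P x)
    (hA : DifferentiableAt ℝ A x)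
    (h : ∀ᶠ y in 𝓝 x, ∀ ξ η, P y (C y ξ η) = gaugeDeriv P A y ξ η) (a b c : V) :
    P x (connectionCurvature C x a b c) = connectionCurvature A x a b (P x c) := by
  have hP1 : DifferentiableAt ℝ P x := hP.differentiableAt (by simp)
  have hP2 : DifferentiableAt ℝ (fderiv ℝ P) x :=
    (hP.fderiv_right (m := 1) (by norm_num)).differentiableAt (by simp)
  have hsymm : fderiv ℝ (fderiv ℝ P) x a b = fderiv ℝ (fderiv ℝ P) x b a :=
    hP.isSymmSndFDerivAt (by simp) a b
  -- The relation `h` applied to fixed `η, c` is differentiated in the direction `ξ`.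
  -- Antisymmetrising in `a, b` then removes the second derivative of `P`.
  have key (ξ η : V) : fderiv ℝ P x ξ (C x η c) + P x (fderiv ℝ C x ξ η c)
      = fderiv ℝ (fderiv ℝ P) x ξ η c + fderiv ℝ A x ξ η (P x c)
        + A x η (fderiv ℝ P x ξ c) := by
    have h1 := (hP1.hasFDerivAt.clm_apply (fderiv_apply_apply hC η c)).fderiv
    have h2 := ((fderiv_apply_apply hP2 η c).add
      ((hA.hasFDerivAt.clm_apply (hasFDerivAt_const η x)).clm_apply
        (hP1.hasFDerivAt.clm_apply (hasFDerivAt_const c x)))).fderiv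
    have h3 : (fun y ↦ P y (C y η c)) =ᶠ[𝓝 x]
        (fun y ↦ fderiv ℝ P y η c) + fun y ↦ A y η (P y c) := by
      filter_upwards [h] with y hy using hy η c
    have := DFunLike.congr_fun (h1.symm.trans (h3.fderiv_eq.trans h2)) ξ
    simp at this
    rw [add_comm, this]; abel
  have e1 := key a b
  have e2 := key b a
  have e3 := h.self_of_nhds a (C x b c)
  have e4 := h.self_of_nhds b (C x a c)
  have e5 := h.self_of_nhds b c
  have e6 := h.self_of_nhds a c
  simp only [gaugeDeriv] at e3 e4 e5 e6
  rw [e5, map_add] at e3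
  rw [e6, map_add] at e4
  rw [hsymm] at e1
  simp only [connectionCurvature, map_add, map_sub]
  rw [e3, e4, eq_sub_of_add_eq' e1, eq_sub_of_add_eq' e2]
  abel

end LocalConnection

/-! ### The Sasaki metric over a coordinate domain -/

section LocalSasaki

open scoped Topology
open ContinuousLinearMap

variable {V : Type*} [NormedAddCommGroup V] [NormedSpace ℝ V]

/-- The orthogonal sum of two copies of `G`, at the points of `U × V`. -/
def doubleForm (G : V → V →L[ℝ] V →L[ℝ] ℝ) (p : V × V) : V × V →L[ℝ] V × V →L[ℝ] ℝ :=
  ((fst ℝ V V).precomp ℝ).comp ((G p.1).comp (fst ℝ V V))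
    + ((snd ℝ V V).precomp ℝ).comp ((G p.1).comp (snd ℝ V V))

/-- The map which sends the components of a tangent vector to the tangent bundle to its horizontal
and vertical parts with respect to the connection `d + Γ`. -/
def splitting (Γ : V → V →L[ℝ] V →L[ℝ] V) (p : V × V) : V × V →L[ℝ] V × V :=
  (fst ℝ V V).prod (snd ℝ V V + ((Γ p.1).flip p.2).comp (fst ℝ V V))

/-- The direct sum of two copies of the connection `d + Γ`, pulled back to the tangent bundle. -/
def doubleConnection (Γ : V → V →L[ℝ] V →L[ℝ] V) (p : V × V) :
    V × V →L[ℝ] V × V →L[ℝ] V × V :=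
  (prodMapL ℝ V V V V).comp (((Γ p.1).comp (fst ℝ V V)).prod ((Γ p.1).comp (fst ℝ V V)))

/-- The Sasaki metric of `G` in induced coordinates. -/
def localSasaki (G : V → V →L[ℝ] V →L[ℝ] ℝ) (p : V × V) : V × V →L[ℝ] V × V →L[ℝ] ℝ :=
  ((splitting (leviCivita G) p).precomp ℝ).comp
    ((doubleForm G p).comp (splitting (leviCivita G) p))

@[simp]
theorem doubleForm_apply (G : V → V →L[ℝ] V →L[ℝ] ℝ) (p ξ η : V × V) :
    doubleForm G p ξ η = G p.1 ξ.1 η.1 + G p.1 ξ.2 η.2 := rfl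

@[simp]
theorem splitting_apply (Γ : V → V →L[ℝ] V →L[ℝ] V) (p ξ : V × V) :
    splitting Γ p ξ = (ξ.1, ξ.2 + Γ p.1 ξ.1 p.2) := rfl

@[simp]
theorem doubleConnection_apply (Γ : V → V →L[ℝ] V →L[ℝ] V) (p ξ η : V × V) :
    doubleConnection Γ p ξ η = (Γ p.1 ξ.1 η.1, Γ p.1 ξ.1 η.2) := rfl

theorem localSasaki_apply (G : V → V →L[ℝ] V →L[ℝ] ℝ) (p ξ η : V × V) :
    localSasaki G p ξ η
      = doubleForm G p (splitting (leviCivita G) p ξ) (splitting (leviCivita G) p η) := rfl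

/-- The splitting is a shear; the inverse is the shear with the opposite sign. -/
theorem isInvertible_splitting (Γ : V → V →L[ℝ] V →L[ℝ] V) (p : V × V) :
    (splitting Γ p).IsInvertible :=
  IsInvertible.of_inverse (g := (fst ℝ V V).prod (snd ℝ V V - ((Γ p.1).flip p.2).comp (fst ℝ V V)))
    (by ext ξ <;> simp) (by ext ξ <;> simp)

section Smoothness

variable {n : WithTop ℕ∞} {p : V × V}

theorem ContDiffAt.clm_prod {X Y Z : Type*} [NormedAddCommGroup X] [NormedSpace ℝ X]
    [NormedAddCommGroup Y] [NormedSpace ℝ Y] [NormedAddCommGroup Z] [NormedSpace ℝ Z]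
    {f : V → X →L[ℝ] Y} {g : V → X →L[ℝ] Z} {x : V} (hf : ContDiffAt ℝ n f x)
    (hg : ContDiffAt ℝ n g x) : ContDiffAt ℝ n (fun y ↦ (f y).prod (g y)) x := by
  have h : (fun y ↦ (f y).prod (g y))
      = fun y ↦ (inl ℝ Y Z).comp (f y) + (inr ℝ Y Z).comp (g y) := by
    funext y; ext v <;> simp
  rw [h]
  exact (contDiffAt_const.clm_comp hf).add (contDiffAt_const.clm_comp hg)

theorem contDiffAt_doubleForm {G : V → V →L[ℝ] V →L[ℝ] ℝ} (hG : ContDiffAt ℝ n G p.1) :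
    ContDiffAt ℝ n (doubleForm G) p := by
  have h : ContDiffAt ℝ n (fun q : V × V ↦ G q.1) p := hG.comp p contDiffAt_fst
  exact (contDiffAt_const.clm_comp (h.clm_comp contDiffAt_const)).add
    (contDiffAt_const.clm_comp (h.clm_comp contDiffAt_const))

theorem contDiffAt_doubleConnection {Γ : V → V →L[ℝ] V →L[ℝ] V} (hΓ : ContDiffAt ℝ n Γ p.1) :
    ContDiffAt ℝ n (doubleConnection Γ) p := by
  have h : ContDiffAt ℝ n (fun q : V × V ↦ (Γ q.1).comp (fst ℝ V V)) p :=
    (hΓ.comp p contDiffAt_fst).clm_comp contDiffAt_const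
  have h' : ContDiffAt ℝ n
      (fun q : V × V ↦ ((Γ q.1).comp (fst ℝ V V)).prod ((Γ q.1).comp (fst ℝ V V))) p :=
    h.clm_prod h
  exact contDiffAt_const.clm_comp h'

theorem contDiffAt_splitting {Γ : V → V →L[ℝ] V →L[ℝ] V} (hΓ : ContDiffAt ℝ n Γ p.1) :
    ContDiffAt ℝ n (splitting Γ) p := by
  have h : ContDiffAt ℝ n (fun q : V × V ↦ (Γ q.1).flip q.2) p :=
    ((flipₗᵢ ℝ V V V).toContinuousLinearEquiv.contDiff.contDiffAt.comp p
      (hΓ.comp p contDiffAt_fst)).clm_apply contDiffAt_snd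
  have h' : ContDiffAt ℝ n
      (fun q : V × V ↦ snd ℝ V V + ((Γ q.1).flip q.2).comp (fst ℝ V V)) p :=
    contDiffAt_const.add (h.clm_comp contDiffAt_const)
  exact ContDiffAt.clm_prod contDiffAt_const h'

end Smoothness

theorem fderiv_splitting {Γ : V → V →L[ℝ] V →L[ℝ] V} {p : V × V} (hΓ : ContDiffAt ℝ 1 Γ p.1)
    (ξ η : V × V) :
    fderiv ℝ (splitting Γ) p ξ η = (0, fderiv ℝ Γ p.1 ξ.1 η.1 p.2 + Γ p.1 η.1 ξ.2) := by
  have hP : DifferentiableAt ℝ (splitting Γ) p :=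
    (contDiffAt_splitting hΓ).differentiableAt one_ne_zero
  have hΓ' : HasFDerivAt (fun q : V × V ↦ Γ q.1) ((fderiv ℝ Γ p.1).comp (fst ℝ V V)) p :=
    (hΓ.differentiableAt one_ne_zero).hasFDerivAt.comp p hasFDerivAt_fst
  have h1 := hP.hasFDerivAt.clm_apply (hasFDerivAt_const η p)
  have h2 : HasFDerivAt (fun q : V × V ↦ splitting Γ q η) _ p :=
    (hasFDerivAt_const η.1 p).prodMk ((hasFDerivAt_const η.2 p).add
      ((hΓ'.clm_apply (hasFDerivAt_const η.1 p)).clm_apply hasFDerivAt_snd))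
  have := DFunLike.congr_fun (h1.unique h2) ξ
  simp at this
  rw [this, add_comm]

theorem fderiv_doubleForm {G : V → V →L[ℝ] V →L[ℝ] ℝ} {p : V × V} (hG : ContDiffAt ℝ 1 G p.1)
    (ξ η ζ : V × V) :
    fderiv ℝ (doubleForm G) p ξ η ζ
      = fderiv ℝ G p.1 ξ.1 η.1 ζ.1 + fderiv ℝ G p.1 ξ.1 η.2 ζ.2 := by
  have hB : DifferentiableAt ℝ (doubleForm G) p :=
    (contDiffAt_doubleForm hG).differentiableAt one_ne_zero
  have hG' := hG.differentiableAt one_ne_zero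
  have h1 := fderiv_apply_apply hB η ζ
  have h2 : HasFDerivAt (fun q : V × V ↦ doubleForm G q η ζ) _ p :=
    ((fderiv_apply_apply hG' η.1 ζ.1).comp p hasFDerivAt_fst).add
      ((fderiv_apply_apply hG' η.2 ζ.2).comp p hasFDerivAt_fst)
  simpa using DFunLike.congr_fun (h1.unique h2) ξ

theorem fderiv_doubleConnection {Γ : V → V →L[ℝ] V →L[ℝ] V} {p : V × V}
    (hΓ : ContDiffAt ℝ 1 Γ p.1) (ξ η ζ : V × V) :
    fderiv ℝ (doubleConnection Γ) p ξ η ζ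
      = (fderiv ℝ Γ p.1 ξ.1 η.1 ζ.1, fderiv ℝ Γ p.1 ξ.1 η.1 ζ.2) := by
  have hB : DifferentiableAt ℝ (doubleConnection Γ) p :=
    (contDiffAt_doubleConnection hΓ).differentiableAt one_ne_zero
  have hΓ' := hΓ.differentiableAt one_ne_zero
  have h1 := fderiv_apply_apply hB η ζ
  have h2 : HasFDerivAt (fun q : V × V ↦ doubleConnection Γ q η ζ) _ p :=
    ((fderiv_apply_apply hΓ' η.1 ζ.1).comp p hasFDerivAt_fst).prodMk
      ((fderiv_apply_apply hΓ' η.1 ζ.2).comp p hasFDerivAt_fst)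
  simpa using DFunLike.congr_fun (h1.unique h2) ξ

theorem connectionCurvature_doubleConnection {Γ : V → V →L[ℝ] V →L[ℝ] V} {p : V × V}
    (hΓ : ContDiffAt ℝ 1 Γ p.1) (ξ η ζ : V × V) :
    connectionCurvature (doubleConnection Γ) p ξ η ζ
      = (connectionCurvature Γ p.1 ξ.1 η.1 ζ.1, connectionCurvature Γ p.1 ξ.1 η.1 ζ.2) := by
  simp [connectionCurvature, fderiv_doubleConnection hΓ]

/-- For symmetric `Γ`, the part antisymmetric in `ξ, η` is `(0, R(ξ.1, η.1) p.2)`, the torsion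
obstructing the identification with the Levi-Civita connection. -/
theorem gaugeDeriv_splitting {Γ : V → V →L[ℝ] V →L[ℝ] V} {p : V × V}
    (hΓ : ContDiffAt ℝ 1 Γ p.1) (ξ η : V × V) :
    gaugeDeriv (splitting Γ) (doubleConnection Γ) p ξ η = (Γ p.1 ξ.1 η.1,
      fderiv ℝ Γ p.1 ξ.1 η.1 p.2 + Γ p.1 η.1 ξ.2 + Γ p.1 ξ.1 (η.2 + Γ p.1 η.1 p.2)) := by
  simp [gaugeDeriv, fderiv_splitting hΓ]

namespace IsLocalMetric

variable [FiniteDimensional ℝ V] {G : V → V →L[ℝ] V →L[ℝ] ℝ} {U : Set V}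

theorem contDiffAt_leviCivita (hG : IsLocalMetric G U) {x : V} (hx : x ∈ U) :
    ContDiffAt ℝ ∞ (leviCivita G) x :=
  hG.contDiffOn_leviCivita.contDiffAt (hG.isOpen.mem_nhds hx)

theorem localSasaki (hG : IsLocalMetric G U) :
    IsLocalMetric (localSasaki G) (U ×ˢ Set.univ) where
  isOpen := hG.isOpen.prod isOpen_univ
  symm p hp ξ η := by
    simp only [localSasaki_apply, doubleForm_apply]
    rw [hG.symm _ hp.1, hG.symm _ hp.1 (splitting _ p ξ).2]
  nondegenerate p hp ξ h := by
    have hinv := isInvertible_splitting (leviCivita G) p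
    have h0 : splitting (leviCivita G) p ξ = 0 := by
      refine Prod.ext (hG.nondegenerate _ hp.1 _ fun w ↦ ?_) (hG.nondegenerate _ hp.1 _ fun w ↦ ?_)
      -- Testing against the vectors with parts `(w, 0)` and `(0, w)` isolates the two summands of
      -- `doubleForm`.
      · simpa [localSasaki_apply, hinv.self_apply_inverse] using
          h ((splitting (leviCivita G) p).inverse (w, 0))
      · have := h ((splitting (leviCivita G) p).inverse (0, w))
        rw [localSasaki_apply, hinv.self_apply_inverse] at this
        simpa using this
    rw [← hinv.inverse_apply_self ξ, h0, map_zero]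
  contDiffOn p hp := by
    have hP := contDiffAt_splitting (p := p) (hG.contDiffAt_leviCivita hp.1)
    have hB := contDiffAt_doubleForm (p := p) (hG.contDiffAt hp.1)
    have hP' : ContDiffAt ℝ ∞
        (fun q ↦ (splitting (leviCivita G) q).precomp ℝ) p :=
      (compL ℝ (V × V) (V × V) ℝ).flip.contDiff.contDiffAt.comp p hP
    exact (hP'.clm_comp (hB.clm_comp hP)).contDiffWithinAt

/-- The Christoffel symbols of the Sasaki metric at the points `(y, u)` with `R(·, ·)u = 0`. -/
theorem splitting_leviCivita_localSasaki (hG : IsLocalMetric G U) {p : V × V} (hp : p.1 ∈ U)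
    (hR : ∀ a b, connectionCurvature (leviCivita G) p.1 a b p.2 = 0) (ξ η : V × V) :
    splitting (leviCivita G) p (leviCivita (_root_.localSasaki G) p ξ η)
      = gaugeDeriv (splitting (leviCivita G)) (doubleConnection (leviCivita G)) p ξ η := by
  have hΓ : ContDiffAt ℝ 1 (leviCivita G) p.1 := (hG.contDiffAt_leviCivita hp).of_le (by simp)
  have hG1 : ContDiffAt ℝ 1 G p.1 := (hG.contDiffAt hp).of_le (by simp)
  refine hG.localSasaki.map_leviCivita ⟨hp, trivial⟩ (B := doubleForm G)
    ((contDiffAt_doubleForm hG1).differentiableAt one_ne_zero)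
    ((contDiffAt_splitting hΓ).differentiableAt one_ne_zero) (isInvertible_splitting _ p)
    (.of_forall fun q v w ↦ rfl) (fun ξ η ζ ↦ ?_) (fun ξ η ↦ ?_) ξ η
  · rw [fderiv_doubleForm hG1, hG.fderiv_eq hp, hG.fderiv_eq hp]
    simp only [doubleForm_apply, doubleConnection_apply]
    ring
  · rw [gaugeDeriv_splitting hΓ, gaugeDeriv_splitting hΓ, hG.leviCivita_symm hp ξ.1 η.1]
    congr 1
    -- The second components differ exactly by the curvature applied to `p.2`.
    have h := hR ξ.1 η.1
    simp only [connectionCurvature] at h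
    rw [← sub_eq_zero, ← h, map_add, map_add]
    abel

/-- The zero section is totally geodesic. -/
theorem leviCivita_localSasaki_zero (hG : IsLocalMetric G U) {y : V} (hy : y ∈ U) (a b : V) :
    leviCivita (_root_.localSasaki G) (y, 0) (a, 0) (b, 0) = (leviCivita G y a b, 0) := by
  have hΓ : ContDiffAt ℝ 1 (leviCivita G) y := (hG.contDiffAt_leviCivita hy).of_le (by simp)
  -- At `u = 0` the condition `R(·, ·) u = 0` is automatic, and the splitting is the identity.
  have h := hG.splitting_leviCivita_localSasaki (p := (y, 0)) hy
    (fun a b ↦ by simp [connectionCurvature]) (a, 0) (b, 0)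
  rw [gaugeDeriv_splitting hΓ] at h
  simpa using h

/-- For arguments tangent to the zero section, the curvature involves derivatives of the Christoffel
symbols along that section only, where `leviCivita_localSasaki_zero` gives their values. -/
theorem connectionCurvature_localSasaki_zero (hG : IsLocalMetric G U) {y : V} (hy : y ∈ U)
    (a b c : V) :
    connectionCurvature (leviCivita (_root_.localSasaki G)) (y, 0) (a, 0) (b, 0) (c, 0)
      = (connectionCurvature (leviCivita G) y a b c, 0) := by
  have hd : DifferentiableAt ℝ (leviCivita (_root_.localSasaki G)) (y, 0) :=
    hG.localSasaki.differentiableAt_leviCivita ⟨hy, trivial⟩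
  have key (a b c : V) : fderiv ℝ (leviCivita (_root_.localSasaki G)) (y, 0) (a, 0) (b, 0) (c, 0)
      = (fderiv ℝ (leviCivita G) y a b c, 0) := by
    have hι : HasFDerivAt (fun z : V ↦ (z, (0 : V))) (inl ℝ V V) y :=
      (hasFDerivAt_id y).prodMk (hasFDerivAt_const 0 y)
    have h1 := (fderiv_apply_apply hd (b, 0) (c, 0)).comp y hι
    have h2 := (fderiv_apply_apply (hG.differentiableAt_leviCivita hy) b c).prodMk
      (hasFDerivAt_const (0 : V) y)
    have h3 : ((fun q ↦ leviCivita (_root_.localSasaki G) q (b, 0) (c, 0)) ∘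
        fun z : V ↦ (z, (0 : V))) =ᶠ[𝓝 y] fun z ↦ (leviCivita G z b c, (0 : V)) := by
      filter_upwards [hG.isOpen.mem_nhds hy] with z hz using hG.leviCivita_localSasaki_zero hz b c
    simpa using DFunLike.congr_fun ((h1.congr_of_eventuallyEq h3.symm).unique h2) a
  simp [connectionCurvature, key, hG.leviCivita_localSasaki_zero hy]

/-- With `R = 0` on `U` the gauge equivalence holds in a neighbourhood of `p`, as gauge covariance
of the curvature requires. -/
theorem connectionCurvature_localSasaki_eq_zero (hG : IsLocalMetric G U)
    (hR : ∀ y ∈ U, ∀ a b c, connectionCurvature (leviCivita G) y a b c = 0) {p : V × V}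
    (hp : p.1 ∈ U) (ξ η ζ : V × V) :
    connectionCurvature (leviCivita (_root_.localSasaki G)) p ξ η ζ = 0 := by
  have hΓ := hG.contDiffAt_leviCivita hp
  have hΓ1 : ContDiffAt ℝ 1 (leviCivita G) p.1 := hΓ.of_le (by simp)
  have h : ∀ᶠ q in 𝓝 p, ∀ ξ η, splitting (leviCivita G) q (leviCivita (_root_.localSasaki G) q ξ η)
      = gaugeDeriv (splitting (leviCivita G)) (doubleConnection (leviCivita G)) q ξ η := by
    filter_upwards [hG.localSasaki.isOpen.mem_nhds (x := p) ⟨hp, trivial⟩] with q hq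
    exact hG.splitting_leviCivita_localSasaki hq.1 fun a b ↦ hR _ hq.1 a b _
  have := map_connectionCurvature (hG.localSasaki.differentiableAt_leviCivita ⟨hp, trivial⟩)
    ((contDiffAt_splitting hΓ).of_le ENat.LEInfty.out)
    ((contDiffAt_doubleConnection hΓ1).differentiableAt one_ne_zero) h ξ η ζ
  rw [connectionCurvature_doubleConnection hΓ1, hR _ hp, hR _ hp] at this
  rw [← (isInvertible_splitting (leviCivita G) p).inverse_apply_self (connectionCurvature _ p ξ η ζ),
    this]
  exact map_zero _

/-- The Sasaki metric is flat if and only if the metric is, in coordinates. -/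
theorem flat_localSasaki_iff (hG : IsLocalMetric G U) :
    (∀ p ∈ U ×ˢ (Set.univ : Set V), ∀ ξ η ζ,
      connectionCurvature (leviCivita (_root_.localSasaki G)) p ξ η ζ = 0) ↔
    ∀ y ∈ U, ∀ a b c, connectionCurvature (leviCivita G) y a b c = 0 := by
  refine ⟨fun h y hy a b c ↦ ?_, fun h p hp ξ η ζ ↦
    hG.connectionCurvature_localSasaki_eq_zero h hp.1 ξ η ζ⟩
  have := h (y, 0) ⟨hy, trivial⟩ (a, 0) (b, 0) (c, 0)
  rw [hG.connectionCurvature_localSasaki_zero hy] at this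
  exact congrArg Prod.fst this

end IsLocalMetric

end LocalSasaki

/-! ### Metrics on manifolds in charts, and changes of coordinates -/

section Coordinates

open scoped Topology

variable {E : Type*} [NormedAddCommGroup E] [NormedSpace ℝ E]
  {H : Type*} [TopologicalSpace H] (I : ModelWithCorners ℝ E H)
  {M : Type*} [TopologicalSpace M] [ChartedSpace H M]
  (g : ∀ x : M, TangentSpace I x →L[ℝ] TangentSpace I x →L[ℝ] ℝ)

theorem curvature_eq_connectionCurvature (x₀ : M) :
    curvature I g x₀ = connectionCurvature (leviCivita (coordMetric I g x₀)) := rfl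

theorem isOpen_coordChange_source [I.Boundaryless] (x₀ x₁ : M) :
    IsOpen ((extChartAt I x₀).symm ≫ extChartAt I x₁).source := by
  rw [PartialEquiv.trans_source, PartialEquiv.symm_source]
  exact (continuousOn_extChartAt_symm x₀).isOpen_inter_preimage (isOpen_extChartAt_target x₀)
    (isOpen_extChartAt_source x₁)

variable [I.Boundaryless] [IsManifold I ∞ M]

/-- Both sides invert the trivialization of the tangent bundle around `x₀`. In the form on the right
the cocycle rules apply. -/
theorem mfderiv_extChartAt_symm_eq_tangentCoordChange {x₀ : M} {y : E}
    (hy : y ∈ (extChartAt I x₀).target) :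
    mfderiv 𝓘(ℝ, E) I (extChartAt I x₀).symm y
      = tangentCoordChange I x₀ ((extChartAt I x₀).symm y) ((extChartAt I x₀).symm y) := by
  have hx : (extChartAt I x₀).symm y ∈ (chartAt H x₀).source := by
    rw [← extChartAt_source I]; exact (extChartAt I x₀).map_target hy
  have h := (TangentBundle.symmL_trivializationAt (I := I) hx).symm.trans
    (TangentBundle.symmL_trivializationAt_eq_core hx)
  rw [(extChartAt I x₀).right_inv hy, I.range_eq_univ, mfderivWithin_univ] at h
  exact h

theorem coordMetric_apply {x₀ : M} {y : E} (hy : y ∈ (extChartAt I x₀).target) (v w : E) :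
    coordMetric I g x₀ y v w = g ((extChartAt I x₀).symm y)
      (tangentCoordChange I x₀ ((extChartAt I x₀).symm y) ((extChartAt I x₀).symm y) v)
      (tangentCoordChange I x₀ ((extChartAt I x₀).symm y) ((extChartAt I x₀).symm y) w) := by
  rw [← mfderiv_extChartAt_symm_eq_tangentCoordChange I hy]; rfl

theorem trivializationAt_metric {x₀ x : M} (hx : x ∈ (chartAt H x₀).source) :
    (trivializationAt (E →L[ℝ] E →L[ℝ] ℝ)
      (fun x : M ↦ TangentSpace I x →L[ℝ] TangentSpace I x →L[ℝ] ℝ) x₀ ⟨x, g x⟩).2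
      = coordMetric I g x₀ (extChartAt I x₀ x) := by
  have hx' : x ∈ (extChartAt I x₀).source := by rwa [extChartAt_source]
  have h : (trivializationAt E (TangentSpace I) x₀).symmL ℝ x
      = tangentCoordChange I x₀ x x :=
    TangentBundle.symmL_trivializationAt_eq_core hx
  ext v w
  rw [coordMetric_apply I g ((extChartAt I x₀).map_source hx'), (extChartAt I x₀).left_inv hx',
    hom_trivializationAt_apply]
  refine (inCoordinates_apply_eq₂ (E₃ := fun _ : M ↦ ℝ) hx hx (Set.mem_univ _)).trans ?_
  rw [Bundle.Trivialization.coe_linearMapAt_of_mem _ (Set.mem_univ _)]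
  have hs (v : E) : (trivializationAt E (TangentSpace I) x₀).symm x v
      = tangentCoordChange I x₀ x x v :=
    (Bundle.Trivialization.symmL_apply (R := ℝ) _ hx v).symm.trans (DFunLike.congr_fun h v)
  exact congrArg₂ (fun a b : TangentSpace I x ↦ g x a b) (hs v) (hs w)

/-- In the trivialization of the bundle of bilinear forms around `x₀`, the section `g` reads
`coordMetric I g x₀`. One direction serves for `g`, the other for the Sasaki metric. -/
theorem contMDiff_metric_iff :
    ContMDiff I (I.prod 𝓘(ℝ, E →L[ℝ] E →L[ℝ] ℝ)) ∞
      (fun x ↦ Bundle.TotalSpace.mk' (E →L[ℝ] E →L[ℝ] ℝ)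
        (E := fun x : M ↦ TangentSpace I x →L[ℝ] TangentSpace I x →L[ℝ] ℝ) x (g x)) ↔
    ∀ x₀ : M, ContDiffOn ℝ ∞ (coordMetric I g x₀) (extChartAt I x₀).target := by
  have key (x₀ : M) : ContMDiffOn I (I.prod 𝓘(ℝ, E →L[ℝ] E →L[ℝ] ℝ)) ∞
      (fun x ↦ Bundle.TotalSpace.mk' (E →L[ℝ] E →L[ℝ] ℝ)
        (E := fun x : M ↦ TangentSpace I x →L[ℝ] TangentSpace I x →L[ℝ] ℝ) x (g x))
        (chartAt H x₀).source ↔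
      ContMDiffOn I 𝓘(ℝ, E →L[ℝ] E →L[ℝ] ℝ) ∞
        (fun x ↦ coordMetric I g x₀ (extChartAt I x₀ x)) (chartAt H x₀).source := by
    rw [Bundle.Trivialization.contMDiffOn_section_iff
      (trivializationAt (E →L[ℝ] E →L[ℝ] ℝ)
        (fun x : M ↦ TangentSpace I x →L[ℝ] TangentSpace I x →L[ℝ] ℝ) x₀)
      (chartAt H x₀).open_source (by intro x hx; exact ⟨hx, hx, trivial⟩)]
    exact contMDiffOn_congr fun x hx ↦ trivializationAt_metric I g hx
  refine ⟨fun h x₀ ↦ ?_, fun h x₀ ↦ ?_⟩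
  · rw [← contMDiffOn_iff_contDiffOn]
    refine (((key x₀).1 h.contMDiffOn).comp (contMDiffOn_extChartAt_symm x₀) ?_).congr ?_
    · intro y hy
      rw [Set.mem_preimage, ← extChartAt_source I]
      exact (extChartAt I x₀).map_target hy
    · intro y hy
      exact congrArg _ ((extChartAt I x₀).right_inv hy).symm
  · refine ((key x₀).2 ?_).contMDiffAt
      ((chartAt H x₀).open_source.mem_nhds (mem_chart_source H x₀))
    refine (contMDiffOn_iff_contDiffOn.2 (h x₀)).comp contMDiffOn_extChartAt ?_
    intro x hx
    rw [← extChartAt_source I] at hx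
    exact (extChartAt I x₀).map_source hx

variable {g}

theorem IsPseudoRiemannianMetric.isLocalMetric (hg : IsPseudoRiemannianMetric I g) (x₀ : M) :
    IsLocalMetric (coordMetric I g x₀) (extChartAt I x₀).target where
  isOpen := isOpen_extChartAt_target x₀
  symm y hy v w := hg.symm _ _ _
  nondegenerate y hy v h := by
    have hinv : (mfderiv 𝓘(ℝ, E) I (extChartAt I x₀).symm y).IsInvertible := by
      rw [← mfderivWithin_univ, ← I.range_eq_univ]
      exact isInvertible_mfderivWithin_extChartAt_symm hy
    have h0 : mfderiv 𝓘(ℝ, E) I (extChartAt I x₀).symm y v = 0 := by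
      refine hg.nondegenerate _ _ fun w ↦ ?_
      rw [← hinv.self_apply_inverse w]
      exact h _
    rw [← hinv.inverse_apply_self v, h0]
    exact map_zero _
  contDiffOn := (contMDiff_metric_iff I g).1 hg.contMDiff x₀

theorem contDiffAt_coordChange {x₀ x₁ : M} {y : E}
    (hy : y ∈ ((extChartAt I x₀).symm ≫ extChartAt I x₁).source) :
    ContDiffAt ℝ ∞ (extChartAt I x₁ ∘ (extChartAt I x₀).symm) y := by
  have := contDiffWithinAt_ext_coord_change (n := ∞) x₁ x₀ hy
  rwa [I.range_eq_univ, contDiffWithinAt_univ] at this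

theorem tangentCoordChange_eq_fderiv {x₀ x₁ : M} {y : E} (hy : y ∈ (extChartAt I x₀).target) :
    tangentCoordChange I x₀ x₁ ((extChartAt I x₀).symm y)
      = fderiv ℝ (extChartAt I x₁ ∘ (extChartAt I x₀).symm) y := by
  rw [tangentCoordChange_def, (extChartAt I x₀).right_inv hy, I.range_eq_univ, fderivWithin_univ]

theorem isInvertible_fderiv_coordChange {x₀ x₁ : M} {y : E}
    (hy : y ∈ ((extChartAt I x₀).symm ≫ extChartAt I x₁).source) :
    (fderiv ℝ (extChartAt I x₁ ∘ (extChartAt I x₀).symm) y).IsInvertible := by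
  have h0 : y ∈ (extChartAt I x₀).target := hy.1
  have hs : (extChartAt I x₀).symm y ∈ (extChartAt I x₀).source := (extChartAt I x₀).map_target h0
  have ht : (extChartAt I x₀).symm y ∈ (extChartAt I x₁).source := hy.2
  rw [← tangentCoordChange_eq_fderiv I h0]
  refine ContinuousLinearMap.IsInvertible.of_inverse
    (g := tangentCoordChange I x₁ x₀ ((extChartAt I x₀).symm y)) ?_ ?_
  · ext v
    exact (tangentCoordChange_comp ⟨⟨ht, hs⟩, ht⟩).trans (tangentCoordChange_self ht)
  · ext v
    exact (tangentCoordChange_comp ⟨⟨hs, ht⟩, hs⟩).trans (tangentCoordChange_self hs)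

variable (g) in
theorem coordMetric_coordChange {x₀ x₁ : M} {y : E}
    (hy : y ∈ ((extChartAt I x₀).symm ≫ extChartAt I x₁).source) (v w : E) :
    coordMetric I g x₀ y v w = coordMetric I g x₁ ((extChartAt I x₁ ∘ (extChartAt I x₀).symm) y)
      (fderiv ℝ (extChartAt I x₁ ∘ (extChartAt I x₀).symm) y v)
      (fderiv ℝ (extChartAt I x₁ ∘ (extChartAt I x₀).symm) y w) := by
  have h0 : y ∈ (extChartAt I x₀).target := hy.1
  have hs : (extChartAt I x₀).symm y ∈ (extChartAt I x₀).source := (extChartAt I x₀).map_target h0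
  have ht : (extChartAt I x₀).symm y ∈ (extChartAt I x₁).source := hy.2
  have hx := mem_extChartAt_source (I := I) ((extChartAt I x₀).symm y)
  rw [coordMetric_apply I g h0, Function.comp_apply,
    coordMetric_apply I g ((extChartAt I x₁).map_source ht), (extChartAt I x₁).left_inv ht,
    ← tangentCoordChange_eq_fderiv I h0, tangentCoordChange_comp ⟨⟨hs, ht⟩, hx⟩,
    tangentCoordChange_comp ⟨⟨hs, ht⟩, hx⟩]

/-- The transformation law of the Christoffel symbols. -/
theorem IsPseudoRiemannianMetric.christoffel_coordChange [FiniteDimensional ℝ E]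
    (hg : IsPseudoRiemannianMetric I g) {x₀ x₁ : M} {y : E}
    (hy : y ∈ ((extChartAt I x₀).symm ≫ extChartAt I x₁).source) (v w : E) :
    fderiv ℝ (extChartAt I x₁ ∘ (extChartAt I x₀).symm) y (christoffel I g x₀ y v w)
      = fderiv ℝ (fderiv ℝ (extChartAt I x₁ ∘ (extChartAt I x₀).symm)) y v w
        + christoffel I g x₁ ((extChartAt I x₁ ∘ (extChartAt I x₀).symm) y)
          (fderiv ℝ (extChartAt I x₁ ∘ (extChartAt I x₀).symm) y v)
          (fderiv ℝ (extChartAt I x₁ ∘ (extChartAt I x₀).symm) y w) := by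
  have hG := hg.isLocalMetric I x₀
  have hG' := hg.isLocalMetric I x₁
  have hτ := contDiffAt_coordChange I hy
  have hop := isOpen_coordChange_source I x₀ x₁
  have hτy : (extChartAt I x₁ ∘ (extChartAt I x₀).symm) y ∈ (extChartAt I x₁).target :=
    (extChartAt I x₁).map_source hy.2
  have hinv := isInvertible_fderiv_coordChange I hy
  have hmet : ∀ᶠ z in 𝓝 y, ∀ v w, coordMetric I g x₀ z v w
      = coordMetric I g x₁ ((extChartAt I x₁ ∘ (extChartAt I x₀).symm) z)
        (fderiv ℝ (extChartAt I x₁ ∘ (extChartAt I x₀).symm) z v)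
        (fderiv ℝ (extChartAt I x₁ ∘ (extChartAt I x₀).symm) z w) := by
    filter_upwards [hop.mem_nhds hy] with z hz using coordMetric_coordChange I g hz
  generalize extChartAt I x₁ ∘ (extChartAt I x₀).symm = τ at *
  have hτ1 : HasFDerivAt τ (fderiv ℝ τ y) y := (hτ.differentiableAt (by simp)).hasFDerivAt
  have hB : HasFDerivAt (fun z ↦ coordMetric I g x₁ (τ z))
      ((fderiv ℝ (coordMetric I g x₁) (τ y)).comp (fderiv ℝ τ y)) y :=
    (hG'.differentiableAt hτy).hasFDerivAt.comp y hτ1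
  -- The gauge transformation is `dτ`, and `B`, `A` are the metric and connection of the second
  -- chart pulled back along `τ`. Freedom from torsion then amounts to the symmetry of `d²τ` and of
  -- the Christoffel symbols.
  refine hG.map_leviCivita hy.1 (B := fun z ↦ coordMetric I g x₁ (τ z)) (P := fderiv ℝ τ)
    (A := fun z ↦ (christoffel I g x₁ (τ z)).comp (fderiv ℝ τ z)) hB.differentiableAt
    ((hτ.fderiv_right (m := ∞) (by simp)).differentiableAt (by simp)) hinv hmet ?_ ?_ v w
  · intro ξ v w
    rw [hB.fderiv]
    exact hG'.fderiv_eq hτy _ _ _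
  · intro ξ η
    have hs : fderiv ℝ (fderiv ℝ τ) y ξ η = fderiv ℝ (fderiv ℝ τ) y η ξ :=
      hτ.isSymmSndFDerivAt (by simpa using ENat.LEInfty.out) ξ η
    simp only [gaugeDeriv, hs]
    congr 1
    exact hG'.leviCivita_symm hτy _ _

end Coordinates

/-! ### The Sasaki metric in induced charts, and flatness -/

section SasakiCoordinates

open scoped Topology

variable {E : Type*} [NormedAddCommGroup E] [NormedSpace ℝ E]
  {H : Type*} [TopologicalSpace H] (I : ModelWithCorners ℝ E H)
  {M : Type*} [TopologicalSpace M] [ChartedSpace H M] [IsManifold I ∞ M]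

theorem extChartAt_tangent_apply (p q : TangentBundle I M) :
    extChartAt I.tangent p q = (extChartAt I p.proj q.proj,
      tangentCoordChange I q.proj p.proj q.proj q.snd) := rfl

theorem extChartAt_tangent_symm_apply (p : TangentBundle I M) (z : E × E) :
    (extChartAt I.tangent p).symm z = ⟨(extChartAt I p.proj).symm z.1,
      tangentCoordChange I p.proj ((extChartAt I p.proj).symm z.1)
        ((extChartAt I p.proj).symm z.1) z.2⟩ := rfl

variable [I.Boundaryless]

theorem extChartAt_tangent_target (p : TangentBundle I M) :
    (extChartAt I.tangent p).target = (extChartAt I p.proj).target ×ˢ Set.univ := by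
  ext z
  simp only [extChartAt, OpenPartialHomeomorph.extend_target, Set.mem_prod, Set.mem_univ, and_true,
    I.range_eq_univ, I.tangent.range_eq_univ, Set.inter_univ, Set.mem_preimage]
  exact TangentBundle.mem_chart_target_iff (I := I) _ p

/-- The coordinate change of the tangent bundle is the tangent map of the coordinate change. -/
theorem coordChange_tangent {p q : TangentBundle I M} {z : E × E}
    (hz : z.1 ∈ ((extChartAt I p.proj).symm ≫ extChartAt I q.proj).source) :
    (extChartAt I.tangent q ∘ (extChartAt I.tangent p).symm) z
      = ((extChartAt I q.proj ∘ (extChartAt I p.proj).symm) z.1,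
        fderiv ℝ (extChartAt I q.proj ∘ (extChartAt I p.proj).symm) z.1 z.2) := by
  rw [Function.comp_apply, extChartAt_tangent_symm_apply, extChartAt_tangent_apply]
  refine Prod.ext rfl ?_
  rw [← tangentCoordChange_eq_fderiv I hz.1]
  exact tangentCoordChange_comp ⟨⟨(extChartAt I p.proj).map_target hz.1,
    mem_extChartAt_source (I := I) _⟩, hz.2⟩

/-- The second derivative of the coordinate change matches the inhomogeneous term in
`christoffel_coordChange`, which makes the vertical part independent of the chart. -/
theorem fderiv_coordChange_tangent {p q : TangentBundle I M} {z : E × E}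
    (hz : z.1 ∈ ((extChartAt I p.proj).symm ≫ extChartAt I q.proj).source) (ξ : E × E) :
    fderiv ℝ (extChartAt I.tangent q ∘ (extChartAt I.tangent p).symm) z ξ
      = (fderiv ℝ (extChartAt I q.proj ∘ (extChartAt I p.proj).symm) z.1 ξ.1,
        fderiv ℝ (extChartAt I q.proj ∘ (extChartAt I p.proj).symm) z.1 ξ.2
          + fderiv ℝ (fderiv ℝ (extChartAt I q.proj ∘ (extChartAt I p.proj).symm)) z.1 ξ.1 z.2) := by
  have h : (extChartAt I.tangent q ∘ (extChartAt I.tangent p).symm) =ᶠ[𝓝 z] fun z ↦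
      ((extChartAt I q.proj ∘ (extChartAt I p.proj).symm) z.1,
        fderiv ℝ (extChartAt I q.proj ∘ (extChartAt I p.proj).symm) z.1 z.2) := by
    filter_upwards [continuous_fst.continuousAt.preimage_mem_nhds
      ((isOpen_coordChange_source I p.proj q.proj).mem_nhds hz)] with z' hz'
    exact coordChange_tangent I hz'
  rw [h.fderiv_eq]
  have hτ := contDiffAt_coordChange I hz
  generalize extChartAt I q.proj ∘ (extChartAt I p.proj).symm = τ at hτ ⊢
  have h1 : HasFDerivAt (fun z : E × E ↦ τ z.1) _ z :=
    (hτ.differentiableAt (by simp)).hasFDerivAt.comp z hasFDerivAt_fst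
  have h2 : HasFDerivAt (fun z : E × E ↦ fderiv ℝ τ z.1) _ z :=
    ((hτ.fderiv_right (m := ∞) (by simp)).differentiableAt (by simp)).hasFDerivAt.comp z
      hasFDerivAt_fst
  rw [(h1.prodMk (h2.clm_apply hasFDerivAt_snd)).fderiv]
  simp

variable [FiniteDimensional ℝ E] {g : ∀ x : M, TangentSpace I x →L[ℝ] TangentSpace I x →L[ℝ] ℝ}

/-- The Sasaki metric in induced coordinates. -/
theorem IsPseudoRiemannianMetric.coordMetric_sasakiMetric (hg : IsPseudoRiemannianMetric I g)
    (p : TangentBundle I M) {z : E × E} (hz : z.1 ∈ (extChartAt I p.proj).target) :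
    coordMetric I.tangent (sasakiMetric I g) p z = localSasaki (coordMetric I g p.proj) z := by
  have hz' : z ∈ (extChartAt I.tangent p).target := by
    rw [extChartAt_tangent_target]; exact ⟨hz, trivial⟩
  -- The Sasaki metric at `q` uses the chart around `q.proj`, while the coordinates `z` belong to
  -- the chart around `p.proj`. The following facts compare the two.
  set q := (extChartAt I.tangent p).symm z
  have hqs : q.snd = fderiv ℝ (extChartAt I q.proj ∘ (extChartAt I p.proj).symm) z.1 z.2 := by
    rw [← tangentCoordChange_eq_fderiv I hz]; rfl
  have hsrc : z.1 ∈ ((extChartAt I p.proj).symm ≫ extChartAt I q.proj).source :=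
    ⟨hz, mem_extChartAt_source (I := I) q.proj⟩
  have hT (ξ : E × E) : tangentCoordChange I.tangent p q q ξ
      = fderiv ℝ (extChartAt I.tangent q ∘ (extChartAt I.tangent p).symm) z ξ := by
    rw [← tangentCoordChange_eq_fderiv I.tangent hz']
  have hΓ := hg.christoffel_coordChange I hsrc
  have hchr : christoffelAt I g q.proj = christoffel I g q.proj
      ((extChartAt I q.proj ∘ (extChartAt I p.proj).symm) z.1) := rfl
  have hv (ξ : E × E) : verticalPart I g q (tangentCoordChange I.tangent p q q ξ)
      = fderiv ℝ (extChartAt I q.proj ∘ (extChartAt I p.proj).symm) z.1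
        (ξ.2 + christoffel I g p.proj z.1 ξ.1 z.2) := by
    rw [hT, fderiv_coordChange_tangent I hsrc]
    change (_ + _) + christoffelAt I g q.proj _ q.snd = _
    rw [map_add, hΓ, hqs, hchr, add_assoc]
    rfl
  have hh (ξ : E × E) : horizontalPart I q (tangentCoordChange I.tangent p q q ξ)
      = fderiv ℝ (extChartAt I q.proj ∘ (extChartAt I p.proj).symm) z.1 ξ.1 := by
    rw [hT, fderiv_coordChange_tangent I hsrc]; rfl
  refine ContinuousLinearMap.ext fun ξ ↦ ContinuousLinearMap.ext fun η ↦ ?_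
  let B : E → E → ℝ := fun a b ↦ g q.proj a b
  refine (coordMetric_apply I.tangent _ hz' ξ η).trans <|
    (congrArg₂ (· + ·) (congrArg₂ B (hh ξ) (hh η)) (congrArg₂ B (hv ξ) (hv η))).trans ?_
  rw [localSasaki_apply, doubleForm_apply, coordMetric_apply I g hz, coordMetric_apply I g hz,
    tangentCoordChange_eq_fderiv I hz]
  rfl

theorem IsPseudoRiemannianMetric.sasakiMetric (hg : IsPseudoRiemannianMetric I g) :
    IsPseudoRiemannianMetric I.tangent (sasakiMetric I g) where
  symm p ξ η := by
    rw [sasakiMetric_apply, sasakiMetric_apply, hg.symm _ (horizontalPart I p ξ),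
      hg.symm _ (verticalPart I g p ξ)]
  nondegenerate p ξ h := by
    have h1 : horizontalPart I p ξ = 0 := hg.nondegenerate _ _ fun X ↦ by
      have := h (horizontalLift I g p X)
      rwa [sasakiMetric_apply, horizontalPart_horizontalLift, verticalPart_horizontalLift, map_zero,
        add_zero] at this
    have h2 : verticalPart I g p ξ = 0 := hg.nondegenerate _ _ fun X ↦ by
      have := h (verticalLift I p X)
      rwa [sasakiMetric_apply, horizontalPart_verticalLift, verticalPart_verticalLift, map_zero,
        zero_add] at this
    rw [← horizontalLift_add_verticalLift I g p ξ, h1, h2]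
    let L : E →L[ℝ] E →L[ℝ] E := christoffelAt I g p.proj
    let u : E := p.snd
    change ((0 : E), -L 0 u) + ((0 : E), (0 : E)) = 0
    simp
  contMDiff := by
    rw [contMDiff_metric_iff]
    intro p
    rw [extChartAt_tangent_target]
    exact (hg.isLocalMetric I p.proj).localSasaki.contDiffOn.congr fun z hz ↦
      hg.coordMetric_sasakiMetric I p hz.1

/-- Curvature depends only on the germ of the metric, so agreement of the two metrics near `z` is
enough. -/
theorem IsPseudoRiemannianMetric.curvature_sasakiMetric (hg : IsPseudoRiemannianMetric I g)
    (p : TangentBundle I M) {z : E × E} (hz : z.1 ∈ (extChartAt I p.proj).target) :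
    curvature I.tangent (_root_.sasakiMetric I g) p z
      = connectionCurvature (leviCivita (localSasaki (coordMetric I g p.proj))) z := by
  have hG : coordMetric I.tangent (_root_.sasakiMetric I g) p
      =ᶠ[𝓝 z] localSasaki (coordMetric I g p.proj) := by
    filter_upwards [(hg.isLocalMetric I p.proj).localSasaki.isOpen.mem_nhds ⟨hz, trivial⟩]
      with z' hz' using hg.coordMetric_sasakiMetric I p hz'.1
  have hΓ : leviCivita (coordMetric I.tangent (_root_.sasakiMetric I g) p)
      =ᶠ[𝓝 z] leviCivita (localSasaki (coordMetric I g p.proj)) := by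
    filter_upwards [hG.eventuallyEq_nhds] with z' hz'
    rw [leviCivita, leviCivita, leviCivitaFirst, leviCivitaFirst, hz'.fderiv_eq, hz'.eq_of_nhds]
  rw [curvature_eq_connectionCurvature]
  funext a b c
  rw [connectionCurvature, connectionCurvature, hΓ.fderiv_eq, hΓ.eq_of_nhds]

theorem IsPseudoRiemannianMetric.isFlatMetric_sasakiMetric_iff
    (hg : IsPseudoRiemannianMetric I g) :
    IsFlatMetric I.tangent (_root_.sasakiMetric I g) ↔ IsFlatMetric I g := by
  have key (p : TangentBundle I M) :
      (∀ z ∈ (extChartAt I.tangent p).target, ∀ ξ η ζ : E × E,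
        curvature I.tangent (_root_.sasakiMetric I g) p z ξ η ζ = 0) ↔
      ∀ y ∈ (extChartAt I p.proj).target, ∀ a b c : E, curvature I g p.proj y a b c = 0 := by
    rw [extChartAt_tangent_target]
    refine Iff.trans ?_ (hg.isLocalMetric I p.proj).flat_localSasaki_iff
    refine forall₂_congr fun z hz ↦ ?_
    rw [hg.curvature_sasakiMetric I p hz.1]
  -- Any vector at `x₀` would do in place of `0`: the target of the chart around `p` and the metric
  -- in it depend only on `p.proj`.
  exact ⟨fun h x₀ ↦ (key ⟨x₀, 0⟩).1 (h _), fun h p ↦ (key p).2 (h _)⟩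

end SasakiCoordinates

end

theorem mainTheorem4
    {E : Type*} [NormedAddCommGroup E] [NormedSpace ℝ E] [FiniteDimensional ℝ E]
    {H : Type*} [TopologicalSpace H] (I : ModelWithCorners ℝ E H) [I.Boundaryless]
    {M : Type*} [TopologicalSpace M] [ChartedSpace H M] [IsManifold I ∞ M]
    (g : ∀ x : M, TangentSpace I x →L[ℝ] TangentSpace I x →L[ℝ] ℝ)
    (hg : IsPseudoRiemannianMetric I g) :
    IsPseudoRiemannianMetric I.tangent (sasakiMetric I g) ∧
      (IsFlatMetric I.tangent (sasakiMetric I g) ↔ IsFlatMetric I g) :=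
  ⟨hg.sasakiMetric, hg.isFlatMetric_sasakiMetric_iff⟩
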